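/- **Theorem.** Let $S_n$ be the symmetric group on $\{1,\dots,n\}$, $n\ge 1$. A finite subset $Y=\{y_1,\dots,y_k\}$ (with $k$ distinct elements) of a group $G$ is called *totally symmetric* if for every $\sigma\in S_k$ there is $g_\sigma\in G$ with $g_\sigma y_i g_\sigma^{-1}=y_{\sigma(i)}$ for all $i$. Two subsets $Y,Z$ of $G$ are *conjugate* if $Y=gZg^{-1}$ for some $g\in G$. Let $X_n=\{(1\;i)\mid i=2,\dots,n\}\subset S_n$. 1. If $n\notin\{2,3,4,6\}$, then a subset $Y\subset S_n$ is totally symmetric of cardinality $n-1$ if and only if $Y$ is conjugate to $X_n$. 2. The group $S_6$ has a non-inner automorphism. If $\rho$ is any non-inner automorphism of $S_6$, then a subset $Y\subset S_6$ is totally symmetric of cardinality $5$ if and only if $Y$ is conjugate to $X_6$ or to $\rho(X_6)$. 3. A subset $Y\subset S_4$ is totally symmetric of cardinality $3$ if and only if $Y$ is conjugate to $X_4$, or conjugate to $\{(1\;2),(1\;3),(2\;3)\}$, or equal to $\{(1\;2)(3\;4),(1\;3)(2\;4),(1\;4)(2\;3)\}$. 4. A subset $Y\subset S_3$ is totally symmetric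 if and only if it is contained in a conjugacy class of $S_3$. In particular every totally symmetric subset of $S_3$ has cardinality at most $3$, and $\{(1\;2),(1\;3),(2\;3)\}$ is a totally symmetric subset of $S_3$ of cardinality $3$. -/

import Mathlib

/-- A subset `Y` of a group `G` is totally symmetric if every permutation of `Y` is realized by
conjugation by some element of `G`. -/
def IsTotallySymmetric {G : Type*} [Group G] (Y : Set G) : Prop :=
  ∀ σ : Equiv.Perm Y, ∃ g : G, ∀ y : Y, g * (y : G) * g⁻¹ = (σ y : G)

/-- Two subsets `Y`, `Z` of a group are conjugate if `Y = g Z g⁻¹` for some `g`. -/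
def IsConjSet {G : Type*} [Group G] (Y Z : Set G) : Prop :=
  ∃ g : G, Y = (fun z => g * z * g⁻¹) '' Z

/-- An automorphism is inner if it is conjugation by some element, that is, if it represents the
trivial class of the outer automorphism group. -/
def IsInnerAut {G : Type*} [Group G] (ρ : G ≃* G) : Prop :=
  ∃ g : G, ∀ x : G, ρ x = g * x * g⁻¹

/-- The set `X_n = {(1 i) | i = 2, …, n}` of transpositions in `S_n`. The letter `i` of
`{1, …, n}` is the element of `Fin n` with value `i - 1`. -/
def starTranspositions (n : ℕ) : Set (Equiv.Perm (Fin n)) :=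
  {τ | ∃ a i : Fin n, a.val = 0 ∧ i ≠ a ∧ τ = Equiv.swap a i}

open Equiv Equiv.Perm

/-! ### Total symmetry in an arbitrary group -/

section TotallySymmetric

variable {G H : Type*} [Group G] [Group H]

/-! A totally symmetric set lies in one conjugacy class, and the centralizer of each member `y`
induces every permutation of the other members. With `n - 1` members this gives `(n - 2)! ≤ |C(y)|`
(`factorial_le_card_centralizer`). For `n ≥ 6` only the identity, transpositions and, when `n = 6`,
triple transpositions have so large a centralizer (`card_centralizer_lt`). For `n = 5` counting is
too weak; instead `C(y)` must induce `S₃` on the other three members, which excludes every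
nontrivial class but the transpositions.

For transpositions, conjugation is transitive on ordered pairs of distinct members, so either all
pairs commute or none do. Commuting ones are disjoint and too few; pairwise non-commuting ones form
a star or a triangle (`star_or_triangle`), and a triangle is too small once `n ≥ 5`.

For `n = 6`, a non-inner `ρ` must send the star to triple transpositions, since otherwise it would
preserve the star up to conjugacy and be inner. Pulling a set of triple transpositions back along
`ρ` reduces it to the star. Such a `ρ` comes from the action on the six synthematic totals. The
cases `n = 4` and `n = 3` rest on finite checks. -/

theorem isTotallySymmetric_range_iff {ι : Type*} {f : ι → G} (hf : Function.Injective f) :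
    IsTotallySymmetric (Set.range f) ↔
      ∀ σ : Perm ι, ∃ g : G, ∀ i, g * f i * g⁻¹ = f (σ i) := by
  let e : ι ≃ Set.range f := Equiv.ofInjective f hf
  have he : ∀ i, ((e i : Set.range f) : G) = f i := fun _ => rfl
  constructor
  · intro h σ
    obtain ⟨g, hg⟩ := h (e.permCongr σ)
    refine ⟨g, fun i => ?_⟩
    simpa [he, Equiv.permCongr_apply] using hg (e i)
  · intro h σ
    obtain ⟨g, hg⟩ := h (e.symm.permCongr σ)
    refine ⟨g, fun y => ?_⟩
    have := hg (e.symm y)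
    rw [← he, ← he] at this
    simpa [Equiv.permCongr_apply] using this

theorem IsTotallySymmetric.image {Y : Set G} (hY : IsTotallySymmetric Y) (φ : G ≃* H) :
    IsTotallySymmetric (φ '' Y) := by
  have hinj : Function.Injective fun y : Y => φ y := φ.injective.comp Subtype.val_injective
  rw [Set.image_eq_range, isTotallySymmetric_range_iff hinj]
  intro σ
  obtain ⟨g, hg⟩ := hY σ
  exact ⟨φ g, fun i => by simp [← hg i]⟩

theorem IsTotallySymmetric.mono {Y Z : Set G} (hZ : IsTotallySymmetric Z) (h : Y ⊆ Z) :
    IsTotallySymmetric Y := by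
  classical
  intro σ
  let e : Y ≃ {z : Z // (z : G) ∈ Y} :=
    ⟨fun y => ⟨⟨y, h y.2⟩, y.2⟩, fun z => ⟨z.1, z.2⟩, fun _ => rfl, fun _ => rfl⟩
  obtain ⟨g, hg⟩ := hZ (σ.extendDomain e)
  refine ⟨g, fun y => ?_⟩
  have := hg (e y)
  rw [Perm.extendDomain_apply_image] at this
  exact this

theorem isConjSet_iff {Y Z : Set G} : IsConjSet Y Z ↔ ∃ g : G, Y = MulAut.conj g '' Z := Iff.rfl

theorem IsConjSet.isTotallySymmetric {Y Z : Set G} (h : IsConjSet Y Z)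
    (hZ : IsTotallySymmetric Z) : IsTotallySymmetric Y := by
  obtain ⟨g, rfl⟩ := isConjSet_iff.1 h
  exact hZ.image _

theorem IsConjSet.ncard_eq {Y Z : Set G} (h : IsConjSet Y Z) : Y.ncard = Z.ncard := by
  obtain ⟨g, rfl⟩ := isConjSet_iff.1 h
  exact Set.ncard_image_of_injective _ (MulAut.conj g).injective

theorem IsConjSet.image {Y Z : Set G} (h : IsConjSet Y Z) (φ : G ≃* H) :
    IsConjSet (φ '' Y) (φ '' Z) := by
  obtain ⟨g, rfl⟩ := h
  exact ⟨φ g, by simp [Set.image_image]⟩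

theorem IsTotallySymmetric.exists_conj_pair {Y : Set G} (hY : IsTotallySymmetric Y)
    {y₁ y₂ z₁ z₂ : G} (hy₁ : y₁ ∈ Y) (hy₂ : y₂ ∈ Y) (hz₁ : z₁ ∈ Y) (hz₂ : z₂ ∈ Y)
    (hy : y₁ ≠ y₂) (hz : z₁ ≠ z₂) :
    ∃ g : G, g * y₁ * g⁻¹ = z₁ ∧ g * y₂ * g⁻¹ = z₂ := by
  classical
  let a₁ : Y := ⟨y₁, hy₁⟩
  let a₂ : Y := ⟨y₂, hy₂⟩
  let b₁ : Y := ⟨z₁, hz₁⟩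
  let b₂ : Y := ⟨z₂, hz₂⟩
  have ha : a₂ ≠ a₁ := fun h => hy (congrArg Subtype.val h).symm
  have hb : b₁ ≠ b₂ := fun h => hz (congrArg Subtype.val h)
  -- The first swap puts `a₁` at `b₁`; the second brings the image of `a₂` to `b₂` and leaves `b₁`
  -- alone.
  obtain ⟨g, hg⟩ := hY (swap (swap a₁ b₁ a₂) b₂ * swap a₁ b₁)
  refine ⟨g, (hg a₁).trans ?_, (hg a₂).trans ?_⟩
  · rw [Perm.mul_apply, swap_apply_left, swap_apply_of_ne_of_ne _ hb]
    intro h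
    exact ha ((swap a₁ b₁).injective (by rw [← h, swap_apply_left]))
  · simp [b₂]

theorem IsTotallySymmetric.isConj {Y : Set G} (hY : IsTotallySymmetric Y)
    {y z : G} (hy : y ∈ Y) (hz : z ∈ Y) : IsConj y z := by
  classical
  obtain ⟨g, hg⟩ := hY (swap ⟨y, hy⟩ ⟨z, hz⟩)
  exact isConj_iff.2 ⟨g, by simpa using hg ⟨y, hy⟩⟩

/-- A conjugator realizing a permutation that fixes `y` commutes with `y`, and distinct permutations
need distinct conjugators. -/
theorem IsTotallySymmetric.factorial_le_card_centralizer [Finite G] {Y : Set G}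
    (hY : IsTotallySymmetric Y) {y : G} (hy : y ∈ Y) :
    (Y.ncard - 1).factorial ≤ Nat.card (Subgroup.centralizer {y}) := by
  classical
  have : Fintype Y := Fintype.ofFinite _
  let y₀ : Y := ⟨y, hy⟩
  choose g hg using hY
  have hc (σ : Perm {z : Y // z ≠ y₀}) : g (ofSubtype σ) ∈ Subgroup.centralizer {y} := by
    rw [Subgroup.mem_centralizer_singleton_iff]
    have := hg (ofSubtype σ) y₀
    rw [ofSubtype_apply_of_not_mem _ (by simp)] at this
    exact mul_inv_eq_iff_eq_mul.1 this
  have hinj : Function.Injective (fun σ : Perm {z : Y // z ≠ y₀} =>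
      (⟨g (ofSubtype σ), hc σ⟩ : Subgroup.centralizer {y})) := by
    intro σ τ h
    have h' : g (ofSubtype σ) = g (ofSubtype τ) := congrArg Subtype.val h
    refine ofSubtype_injective (Equiv.ext fun z => Subtype.ext ?_)
    rw [← hg, ← hg, h']
  have := Nat.card_le_card_of_injective _ hinj
  rwa [Nat.card_eq_fintype_card, Fintype.card_perm, Fintype.card_subtype_compl,
    Fintype.card_subtype_eq, ← Nat.card_eq_fintype_card, Nat.card_coe_set_eq] at this

theorem exists_injective_range_eq {α : Type*} [Finite α] {Y : Set α} {k : ℕ} (hk : Y.ncard = k) :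
    ∃ f : Fin k → α, Function.Injective f ∧ Set.range f = Y := by
  let e : Fin k ≃ Y := (Finite.equivFinOfCardEq (by rwa [Nat.card_coe_set_eq])).symm
  exact ⟨fun i => e i, Subtype.val_injective.comp e.injective,
    by rw [← Function.comp_def, Set.range_comp, e.range_eq_univ]; simp⟩

theorem exists_injective_range_eq_of_mem {α : Type*} [Finite α] {Y : Set α} {k : ℕ}
    (hk : Y.ncard = k + 1) {y : α} (hy : y ∈ Y) :
    ∃ f : Fin (k + 1) → α, Function.Injective f ∧ Set.range f = Y ∧ f 0 = y := by
  obtain ⟨f, hf, rfl⟩ := exists_injective_range_eq hk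
  obtain ⟨i, rfl⟩ := hy
  exact ⟨f ∘ swap 0 i, hf.comp (swap 0 i).injective, by simp [Set.range_comp], by simp⟩

/-- Here `a` and `b` induce a 3-cycle and a transposition on the other three members. These do not
commute, and the eighth power of a 3-cycle is nontrivial. -/
theorem IsTotallySymmetric.exists_not_commute_of_ncard_eq_four [Finite G] {Y : Set G}
    (hY : IsTotallySymmetric Y) (hk : Y.ncard = 4) {y : G} (hy : y ∈ Y) :
    ∃ a b : G, a * y = y * a ∧ b * y = y * b ∧ a * b ≠ b * a ∧ a ^ 8 ≠ 1 := by
  obtain ⟨f, hf, rfl, rfl⟩ := exists_injective_range_eq_of_mem hk hy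
  rw [isTotallySymmetric_range_iff hf] at hY
  obtain ⟨a, ha⟩ := hY (swap 1 2 * swap 2 3)
  obtain ⟨b, hb⟩ := hY (swap 1 2)
  refine ⟨a, b, mul_inv_eq_iff_eq_mul.1 (ha 0), mul_inv_eq_iff_eq_mul.1 (hb 0), fun h => ?_,
    fun h => ?_⟩
  · have h₁ : a * b * f 1 * (a * b)⁻¹ = f 3 := by
      rw [show a * b * f 1 * (a * b)⁻¹ = a * (b * f 1 * b⁻¹) * a⁻¹ by group, hb, ha]
      exact congrArg f (by decide)
    have h₂ : b * a * f 1 * (b * a)⁻¹ = f 1 := by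
      rw [show b * a * f 1 * (b * a)⁻¹ = b * (a * f 1 * a⁻¹) * b⁻¹ by group, ha, hb]
      exact congrArg f (by decide)
    rw [h, h₂] at h₁
    exact absurd (hf h₁) (by decide)
  · have key : ∀ m : ℕ, ∀ i, a ^ m * f i * (a ^ m)⁻¹ =
        f (((swap 1 2 * swap 2 3) ^ m : Perm _) i) := by
      intro m
      induction m with
      | zero => simp
      | succ m ih =>
        intro i
        rw [pow_succ', pow_succ', Perm.mul_apply, ← ha, ← ih]
        group
    have h8 := key 8 1
    rw [h] at h8
    simp only [one_mul, inv_one, mul_one] at h8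
    exact absurd (hf h8) (by decide)

end TotallySymmetric

/-! ### The star of transpositions -/

section Star

theorem starTranspositions_eq_range (n : ℕ) [NeZero n] :
    starTranspositions n = Set.range (fun i : {i : Fin n // i ≠ 0} => swap 0 i.1) := by
  ext τ
  constructor
  · rintro ⟨a, i, ha, hi, rfl⟩
    obtain rfl : a = 0 := Fin.ext (by simpa using ha)
    exact ⟨⟨i, hi⟩, rfl⟩
  · rintro ⟨⟨i, hi⟩, rfl⟩
    exact ⟨0, i, by simp, hi, rfl⟩

theorem injective_swap_left {α : Type*} [DecidableEq α] (a : α) :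
    Function.Injective (fun i : {i : α // i ≠ a} => swap a i.1) := by
  intro i j h
  have := congrArg (fun σ : Perm α => σ a) h
  simpa [Subtype.ext_iff] using this

theorem isTotallySymmetric_starTranspositions (n : ℕ) [NeZero n] :
    IsTotallySymmetric (starTranspositions n) := by
  rw [starTranspositions_eq_range, isTotallySymmetric_range_iff (injective_swap_left 0)]
  intro σ
  refine ⟨ofSubtype σ, fun i => ?_⟩
  rw [← swap_apply_apply, ofSubtype_apply_of_not_mem _ (by simp), ofSubtype_apply_coe]

theorem ncard_range_swap_left {n : ℕ} (a : Fin n) :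
    (Set.range (fun i : {i : Fin n // i ≠ a} => swap a i.1)).ncard = n - 1 := by
  rw [← Set.image_univ, Set.ncard_image_of_injective _ (injective_swap_left a), Set.ncard_univ,
    Nat.card_eq_fintype_card, Fintype.card_subtype_compl, Fintype.card_subtype_eq,
    Fintype.card_fin]

theorem ncard_starTranspositions (n : ℕ) [NeZero n] : (starTranspositions n).ncard = n - 1 := by
  rw [starTranspositions_eq_range, ncard_range_swap_left]

theorem isConjSet_starTranspositions_of_forall_eq_swap {n : ℕ} [NeZero n]
    {Y : Set (Perm (Fin n))} (hY : Y.ncard = n - 1) (a : Fin n)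
    (h : ∀ y ∈ Y, ∃ i, i ≠ a ∧ y = swap a i) : IsConjSet Y (starTranspositions n) := by
  have hsub : Y ⊆ Set.range (fun i : {i : Fin n // i ≠ a} => swap a i.1) := by
    intro y hy
    obtain ⟨i, hi, rfl⟩ := h y hy
    exact ⟨⟨i, hi⟩, rfl⟩
  have hYeq := Set.eq_of_subset_of_ncard_le hsub (by rw [ncard_range_swap_left, hY])
    (Set.toFinite _)
  refine ⟨swap 0 a, ?_⟩
  rw [hYeq, starTranspositions_eq_range]
  ext τ
  constructor
  · rintro ⟨⟨i, hi⟩, rfl⟩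
    refine ⟨swap 0 (swap 0 a i), ⟨⟨swap 0 a i, fun h => hi ?_⟩, rfl⟩, ?_⟩
    · simpa using congrArg (swap 0 a) h
    · simp only [← swap_apply_apply]
      simp
  · rintro ⟨_, ⟨⟨i, hi⟩, rfl⟩, rfl⟩
    refine ⟨⟨swap 0 a i, fun h => hi ?_⟩, ?_⟩
    · simpa using congrArg (swap 0 a) h
    · simp only [← swap_apply_apply]
      simp

theorem closure_starTranspositions (n : ℕ) [NeZero n] :
    Subgroup.closure (starTranspositions n) = ⊤ := by
  have h0 : ∀ i : Fin n, swap 0 i ∈ Subgroup.closure (starTranspositions n) := by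
    intro i
    by_cases hi : i = 0
    · rw [hi, swap_self]; exact one_mem _
    · exact Subgroup.subset_closure ⟨0, i, by simp, hi, rfl⟩
  rw [eq_top_iff, ← closure_isSwap, Subgroup.closure_le]
  rintro _ ⟨i, j, hij, rfl⟩
  by_cases hj : j = 0
  · subst hj; rw [swap_comm]; exact h0 i
  · have : swap i j = swap 0 i * swap 0 j * (swap 0 i)⁻¹ := by
      rw [← swap_apply_apply, swap_apply_left, swap_apply_of_ne_of_ne hj hij.symm]
    rw [this]
    exact mul_mem (mul_mem (h0 i) (h0 j)) (inv_mem (h0 i))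

/-- An automorphism carrying the star of transpositions to a conjugate of itself is inner. -/
theorem isInnerAut_of_isConjSet_image {n : ℕ} [NeZero n] (ρ : Perm (Fin n) ≃* Perm (Fin n))
    (h : IsConjSet (ρ '' starTranspositions n) (starTranspositions n)) : IsInnerAut ρ := by
  obtain ⟨c, hc⟩ := h
  set S := starTranspositions n
  -- Correcting `ρ` by `c` makes it permute the star itself. Total symmetry realizes that
  -- permutation by an inner automorphism, which agrees with `ψ` on generators.
  let ψ : Perm (Fin n) ≃* Perm (Fin n) := ρ.trans (MulAut.conj c⁻¹)
  have hψ : ∀ x, ψ x = c⁻¹ * ρ x * c := fun x => by simp [ψ]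
  have hmaps : ∀ y ∈ S, ψ y ∈ S := by
    intro y hy
    obtain ⟨z, hz, hzy⟩ := hc ▸ Set.mem_image_of_mem ρ hy
    rw [hψ, ← hzy]
    simpa [mul_assoc] using hz
  let f : S → S := fun y => ⟨ψ y, hmaps y y.2⟩
  have hf : Function.Injective f := fun x y hxy =>
    Subtype.ext (ψ.injective (congrArg Subtype.val hxy))
  obtain ⟨g, hg⟩ := isTotallySymmetric_starTranspositions n
    (Equiv.ofBijective f (Finite.injective_iff_bijective.1 hf))
  have heq : (ψ : Perm (Fin n) →* Perm (Fin n)) = (MulAut.conj g).toMonoidHom :=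
    MonoidHom.eq_of_eqOn_dense (closure_starTranspositions n)
      fun y hy => (hg ⟨y, hy⟩).symm
  refine ⟨c * g, fun x => ?_⟩
  have hx : ψ x = g * x * g⁻¹ := DFunLike.congr_fun heq x
  rw [hψ] at hx
  calc ρ x = c * (c⁻¹ * ρ x * c) * c⁻¹ := by group
    _ = c * g * x * (c * g)⁻¹ := by rw [hx]; group

end Star

/-! ### Bounding centralizer orders in `Sₙ` -/

section CentralizerBound

open scoped Nat

theorem Multiset.prod_count_factorial_cons (c : ℕ) (m : Multiset ℕ) :
    (∏ i ∈ (c ::ₘ m).toFinset, ((c ::ₘ m).count i)!) =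
      (m.count c + 1) * ∏ i ∈ m.toFinset, (m.count i)! := by
  -- Enlarging the index set only adds factors `0! = 1`, so both products can be compared over one
  -- set.
  have hsub : ∀ m' : Multiset ℕ, ∀ s : Finset ℕ, m'.toFinset ⊆ s →
      ∏ i ∈ m'.toFinset, (m'.count i)! = ∏ i ∈ s, (m'.count i)! := by
    intro m' s hs
    refine Finset.prod_subset hs fun i _ hi => ?_
    rw [Multiset.count_eq_zero_of_notMem (by simpa using hi), Nat.factorial_zero]
  have hc : c ∈ (c ::ₘ m).toFinset := by simp
  rw [hsub m (c ::ₘ m).toFinset (by simp), ← Finset.mul_prod_erase _ _ hc,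
    ← Finset.mul_prod_erase _ (fun i => (m.count i)!) hc, Multiset.count_cons_self,
    Nat.factorial_succ, mul_assoc]
  congr 2
  refine Finset.prod_congr rfl fun i hi => ?_
  rw [Multiset.count_cons_of_ne (Finset.ne_of_mem_erase hi)]

theorem Nat.doubleFactorial_mono : Monotone Nat.doubleFactorial := by
  have h : ∀ n : ℕ, n‼ ≤ (n + 1)‼ ∧ (n + 1)‼ ≤ (n + 2)‼ := by
    intro n
    induction n with
    | zero => decide
    | succ n ih =>
      refine ⟨ih.2, ?_⟩
      rw [Nat.doubleFactorial_add_two, Nat.doubleFactorial_add_two (n + 1)]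
      exact Nat.mul_le_mul (by lia) ih.1
  exact monotone_nat_of_le_succ fun n => (h n).1

theorem Multiset.mul_count_le_sum (c : ℕ) (m : Multiset ℕ) : c * m.count c ≤ m.sum := by
  induction m using Multiset.induction_on with
  | empty => simp
  | cons a m ih =>
    by_cases h : c = a
    · subst h; rw [Multiset.count_cons_self, Multiset.sum_cons]; nlinarith
    · rw [Multiset.count_cons_of_ne h, Multiset.sum_cons]; lia

/-- The left side is the factor of the centralizer order contributed by the moved points. A new part
`c` multiplies it by `c * (count c + 1) ≤ c + m.sum`. Equality holds when all parts are `2`. -/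
theorem Multiset.prod_mul_prod_count_factorial_le_doubleFactorial (m : Multiset ℕ)
    (hm : ∀ c ∈ m, 2 ≤ c) :
    m.prod * ∏ i ∈ m.toFinset, (m.count i)! ≤ m.sum‼ := by
  induction m using Multiset.induction_on with
  | empty => simp
  | cons c m ih =>
    have ih := ih fun d hd => hm d (Multiset.mem_cons_of_mem hd)
    obtain ⟨d, rfl⟩ : ∃ d, c = d + 2 := Nat.exists_eq_add_of_le' (hm c (by simp))
    have h₁ := Multiset.mul_count_le_sum (d + 2) m
    rw [Multiset.prod_count_factorial_cons, Multiset.prod_cons, Multiset.sum_cons,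
      show d + 2 + m.sum = (d + m.sum) + 2 by ring, Nat.doubleFactorial_add_two]
    calc (d + 2) * m.prod * ((m.count (d + 2) + 1) * ∏ i ∈ m.toFinset, (m.count i)!)
        = ((d + 2) * (m.count (d + 2) + 1)) * (m.prod * ∏ i ∈ m.toFinset, (m.count i)!) := by
          ring
      _ ≤ (d + m.sum + 2) * (d + m.sum)‼ := Nat.mul_le_mul (by nlinarith)
          (ih.trans (Nat.doubleFactorial_mono (by lia)))

/-- The general bound `6‼ = 48` exceeds `4! = 24`. Removing a part `c ≥ 3` leaves sum at most `3`,
and the bound drops to `6 * 3‼ = 18`. -/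
theorem Multiset.prod_mul_prod_count_factorial_lt_of_sum_eq_six {m : Multiset ℕ}
    (hm : ∀ c ∈ m, 2 ≤ c) (hs : m.sum = 6) {c : ℕ} (hc : c ∈ m) (h3 : 3 ≤ c) :
    m.prod * ∏ i ∈ m.toFinset, (m.count i)! < 24 := by
  obtain ⟨m, rfl⟩ := Multiset.exists_cons_of_mem hc
  have ih := m.prod_mul_prod_count_factorial_le_doubleFactorial
    fun d hd => hm d (Multiset.mem_cons_of_mem hd)
  have h₁ := Multiset.mul_count_le_sum c m
  rw [Multiset.sum_cons] at hs
  rw [Multiset.prod_count_factorial_cons, Multiset.prod_cons]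
  calc c * m.prod * ((m.count c + 1) * ∏ i ∈ m.toFinset, (m.count i)!)
      = (c * (m.count c + 1)) * (m.prod * ∏ i ∈ m.toFinset, (m.count i)!) := by ring
    _ ≤ 6 * 3‼ := Nat.mul_le_mul (by nlinarith)
        (ih.trans (Nat.doubleFactorial_mono (by lia)))
    _ < 24 := by decide

theorem Nat.factorial_mul_doubleFactorial_lt {f s : ℕ} (hs : 3 ≤ s) (h : 6 ≤ f + s)
    (h6 : s = 6 → 1 ≤ f) : f ! * s‼ < (f + s - 2)! := by
  -- Raising `f` by one multiplies the left side by `f + 1` and the right side by `f + s₀ - 1`,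
  -- which is no smaller. So the least admissible `f` suffices for each `s`.
  have base : ∀ s₀ f₀ : ℕ, 2 ≤ s₀ → f₀ ! * s₀‼ < (f₀ + s₀ - 2)! →
      ∀ f, f₀ ≤ f → f ! * s₀‼ < (f + s₀ - 2)! := by
    intro s₀ f₀ hs₀ h₀ f hf
    induction f, hf using Nat.le_induction with
    | base => exact h₀
    | succ f _ ih =>
      rw [Nat.factorial_succ, show f + 1 + s₀ - 2 = (f + s₀ - 2) + 1 by lia, Nat.factorial_succ,
        mul_assoc]
      exact Nat.mul_lt_mul_of_le_of_lt (by lia) ih (by lia)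
  have step : ∀ s, 7 ≤ s → s‼ < (s - 2)! ∧ (s + 1)‼ < (s + 1 - 2)! := by
    intro s hs
    induction s, hs using Nat.le_induction with
    | base => decide
    | succ s hs ih =>
      refine ⟨ih.2, ?_⟩
      obtain ⟨t, rfl⟩ : ∃ t, s = t + 2 := Nat.exists_eq_add_of_le' (by lia)
      rw [show t + 2 + 1 + 1 = (t + 2) + 2 by ring, Nat.doubleFactorial_add_two,
        show t + 2 + 2 - 2 = t + 1 + 1 by lia, Nat.factorial_succ, Nat.factorial_succ]
      have := ih.1
      rw [show t + 2 - 2 = t by lia] at this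
      calc (t + 2 + 2) * (t + 2)‼ < (t + 2 + 2) * t ! := by gcongr
        _ ≤ ((t + 1 + 1) * (t + 1)) * t ! := by gcongr; nlinarith
        _ = _ := by ring
  rcases lt_or_ge s 7 with h7 | h7
  · interval_cases s
    · exact base 3 3 (by lia) (by decide) f (by lia)
    · exact base 4 2 (by lia) (by decide) f (by lia)
    · exact base 5 1 (by lia) (by decide) f (by lia)
    · exact base 6 1 (by lia) (by decide) f (by lia)
  · exact base s 0 (by lia) (by simpa using (step s h7).1) f (by lia)

variable {n : ℕ}

theorem Equiv.Perm.card_centralizer_lt {y : Perm (Fin n)} (hn : 6 ≤ n) (h1 : y ≠ 1)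
    (hy : ¬ y.IsSwap) (h6 : n = 6 → y.cycleType ≠ {2, 2, 2}) :
    Nat.card (Subgroup.centralizer {y}) < (n - 2)! := by
  have hsum := y.sum_cycleType
  have hle : y.cycleType.sum ≤ n := by
    rw [hsum]; simpa using Finset.card_le_univ y.support
  have h3 : 3 ≤ y.cycleType.sum := by
    have := y.two_le_card_support_of_ne_one h1
    have := mt card_support_eq_two.1 hy
    lia
  have hm : ∀ c ∈ y.cycleType, 2 ≤ c := fun c hc => two_le_of_mem_cycleType hc
  rw [nat_card_centralizer, Fintype.card_fin, mul_assoc]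
  -- With six moved points and none fixed, the double factorial bound fails; a cycle of length at
  -- least `3` is needed.
  by_cases hs : y.cycleType.sum = 6 ∧ n = 6
  · obtain ⟨hs, rfl⟩ := hs
    rw [hs]
    have : ∃ c ∈ y.cycleType, 3 ≤ c := by
      by_contra! hcon
      have hrep := Multiset.eq_replicate_card.2 fun c hc =>
        (le_antisymm (Nat.le_of_lt_succ (hcon c hc)) (hm c hc) : c = 2)
      have hcard : y.cycleType.card * 2 = 6 := by
        rw [hrep, Multiset.sum_replicate, smul_eq_mul] at hs
        exact hs
      rw [show y.cycleType.card = 3 by lia] at hrep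
      exact h6 rfl hrep
    obtain ⟨c, hc, hc3⟩ := this
    simpa [show (4)! = 24 by decide] using
      Multiset.prod_mul_prod_count_factorial_lt_of_sum_eq_six hm hs hc hc3
  · have := Nat.factorial_mul_doubleFactorial_lt (f := n - y.cycleType.sum) h3 (by lia) (by lia)
    rw [show n - y.cycleType.sum + y.cycleType.sum - 2 = n - 2 by lia] at this
    exact (Nat.mul_le_mul_left _
      (Multiset.prod_mul_prod_count_factorial_le_doubleFactorial _ hm)).trans_lt this

end CentralizerBound

/-! ### Totally symmetric sets of transpositions -/

section Swaps

variable {α : Type*} [DecidableEq α]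

theorem exists_swap_of_not_commute {a b : α} {y : Perm α} (hy : y.IsSwap)
    (h : ¬ Commute (swap a b) y) : ∃ e, (e ≠ a ∧ y = swap a e) ∨ (e ≠ b ∧ y = swap b e) := by
  obtain ⟨c, d, hcd, rfl⟩ := hy
  by_cases hca : c = a
  · exact ⟨d, .inl ⟨hca ▸ hcd.symm, by rw [hca]⟩⟩
  by_cases hcb : c = b
  · exact ⟨d, .inr ⟨hcb ▸ hcd.symm, by rw [hcb]⟩⟩
  by_cases hda : d = a
  · exact ⟨c, .inl ⟨hca, by rw [hda, swap_comm]⟩⟩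
  by_cases hdb : d = b
  · exact ⟨c, .inr ⟨hcb, by rw [hdb, swap_comm]⟩⟩
  refine absurd ?_ h
  by_cases hab : a = b
  · subst hab; rw [swap_self]; exact Commute.one_left _
  · refine (disjoint_swap_swap ?_).commute
    simp; tauto

theorem not_commute_swap_swap {a b c : α} (hba : b ≠ a) (hca : c ≠ a) (hbc : b ≠ c) :
    ¬ Commute (swap a b) (swap a c) := by
  intro h
  have := congrArg (fun σ : Perm α => σ a) h.eq
  simp [swap_apply_of_ne_of_ne hca hbc.symm, swap_apply_of_ne_of_ne hba hbc] at this
  exact hbc this.symm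

theorem disjoint_of_commute_of_isSwap {x y : Perm α} (hx : x.IsSwap) (hy : y.IsSwap)
    (hxy : x ≠ y) (h : Commute x y) : x.Disjoint y := by
  obtain ⟨a, b, hab, rfl⟩ := hx
  obtain ⟨c, d, hcd, rfl⟩ := hy
  have key : ∀ {a b c : α}, b ≠ a → c ≠ a → swap a b ≠ swap a c →
      ¬ Commute (swap a b) (swap a c) := fun hb hc hne =>
    not_commute_swap_swap hb hc fun h => hne (by rw [h])
  refine disjoint_swap_swap ?_
  simp only [List.nodup_cons, List.mem_cons, List.not_mem_nil, or_false, not_or, not_false_eq_true,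
    List.nodup_nil, and_true]
  refine ⟨⟨hab, ?_, ?_⟩, ⟨?_, ?_⟩, hcd⟩
  · rintro rfl; exact key hab.symm hcd.symm hxy h
  · rintro rfl; rw [swap_comm c a] at hxy h; exact key hab.symm hcd hxy h
  · rintro rfl; rw [swap_comm a b] at hxy h; exact key hab hcd.symm hxy h
  · rintro rfl; rw [swap_comm a b, swap_comm c b] at hxy h; exact key hab hcd hxy h

theorem two_mul_ncard_le_of_pairwise_commute [Fintype α] {Y : Set (Perm α)}
    (hs : ∀ y ∈ Y, y.IsSwap) (hc : Y.Pairwise Commute) : 2 * Y.ncard ≤ Fintype.card α := by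
  classical
  have hd : ∀ x ∈ Y.toFinset, ∀ y ∈ Y.toFinset, x ≠ y → Disjoint x.support y.support := by
    intro x hx y hy hxy
    rw [Set.mem_toFinset] at hx hy
    exact disjoint_iff_disjoint_support.1
      (disjoint_of_commute_of_isSwap (hs x hx) (hs y hy) hxy (hc hx hy hxy))
  have := Finset.card_le_univ (Y.toFinset.biUnion Perm.support)
  rw [Finset.card_biUnion hd, Finset.sum_congr rfl (fun y hy =>
    card_support_eq_two.2 (hs y (by simpa using hy))), Finset.sum_const, smul_eq_mul,
    ← Set.ncard_eq_toFinset_card'] at this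
  lia

/-- A set of pairwise non-commuting transpositions is contained in a star or is a triangle. -/
theorem star_or_triangle {Y : Set (Perm α)}
    (hs : ∀ y ∈ Y, y.IsSwap) (hc : Y.Pairwise fun x y => ¬ Commute x y) {x y : Perm α}
    (hx : x ∈ Y) (hy : y ∈ Y) (hxy : x ≠ y) :
    (∃ a, ∀ y ∈ Y, ∃ i, i ≠ a ∧ y = swap a i) ∨
      ∃ a b c, a ≠ b ∧ a ≠ c ∧ b ≠ c ∧ Y = {swap a b, swap a c, swap b c} := by
  obtain ⟨a, b, c, hab, hac, hbc, hx', hy'⟩ :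
      ∃ a b c, a ≠ b ∧ a ≠ c ∧ b ≠ c ∧ x = swap a b ∧ y = swap a c := by
    obtain ⟨a, b, hab, rfl⟩ := hs x hx
    obtain ⟨e, ⟨he, rfl⟩ | ⟨he, rfl⟩⟩ := exists_swap_of_not_commute (hs y hy) (hc hx hy hxy)
    · exact ⟨a, b, e, hab, he.symm, fun h => hxy (by rw [h]), rfl, rfl⟩
    · exact ⟨b, a, e, hab.symm, he.symm, fun h => hxy (by rw [h, swap_comm]), swap_comm _ _, rfl⟩
  subst hx' hy'
  have key : ∀ z ∈ Y, (∃ i, i ≠ a ∧ z = swap a i) ∨ z = swap b c := by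
    intro z hz
    by_cases h₁ : swap a b = z
    · exact .inl ⟨b, hab.symm, h₁.symm⟩
    by_cases h₂ : swap a c = z
    · exact .inl ⟨c, hac.symm, h₂.symm⟩
    obtain ⟨e, ⟨he, rfl⟩ | ⟨he, rfl⟩⟩ := exists_swap_of_not_commute (hs z hz) (hc hx hz h₁)
    · exact .inl ⟨e, he, rfl⟩
    obtain ⟨d, ⟨hd, hz'⟩ | ⟨hd, hz'⟩⟩ := exists_swap_of_not_commute (hs _ hz) (hc hy hz h₂)
    · exact .inl ⟨d, hd, hz'⟩
    -- Now `z = (b e) = (c d)` with `b ≠ c`, which forces `e = c`.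
    · right
      have h₃ := congrArg (fun σ : Perm α => σ c) hz'
      by_cases hec : e = c
      · rw [hec]
      · simp only [swap_apply_left, swap_apply_of_ne_of_ne hbc.symm (Ne.symm hec)] at h₃
        exact absurd h₃.symm hd
  by_cases hbcY : swap b c ∈ Y
  · right
    refine ⟨a, b, c, hab, hac, hbc, Set.Subset.antisymm (fun z hz => ?_) ?_⟩
    · obtain ⟨i, hi, rfl⟩ | rfl := key z hz
      · by_contra hcon
        simp only [Set.mem_insert_iff, Set.mem_singleton_iff, not_or] at hcon
        have hib : i ≠ b := fun h => hcon.1 (by rw [h])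
        have hic : i ≠ c := fun h => hcon.2.1 (by rw [h])
        -- A further `(a i)` would be disjoint from `(b c)`.
        refine hc hbcY hz (Ne.symm hcon.2.2) (disjoint_swap_swap ?_).commute
        simp; tauto
      · simp
    · rintro z (rfl | rfl | rfl) <;> assumption
  · left
    refine ⟨a, fun z hz => (key z hz).resolve_right ?_⟩
    rintro rfl
    exact hbcY hz

variable {n : ℕ}

theorem IsTotallySymmetric.star_or_triangle {Y : Set (Perm (Fin n))} (hY : IsTotallySymmetric Y)
    (hn : 4 ≤ n) (hk : Y.ncard = n - 1) (hs : ∀ y ∈ Y, y.IsSwap) :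
    IsConjSet Y (starTranspositions n) ∨
      ∃ a b c, a ≠ b ∧ a ≠ c ∧ b ≠ c ∧ Y = {swap a b, swap a c, swap b c} := by
  have : NeZero n := ⟨by lia⟩
  obtain ⟨x, hx, y, hy, hxy⟩ := (Set.one_lt_ncard (s := Y)).1 (by lia)
  have hc : Y.Pairwise fun x y => ¬ Commute x y := by
    intro u hu v hv huv hcomm
    -- One commuting pair makes all pairs commute; disjoint supports then require `2 * (n - 1) ≤ n`.
    have hall : Y.Pairwise Commute := by
      intro z hz w hw hzw
      obtain ⟨g, rfl, rfl⟩ := hY.exists_conj_pair hu hv hz hw huv hzw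
      exact (Commute.conj_iff g).2 hcomm
    have := two_mul_ncard_le_of_pairwise_commute hs hall
    rw [Fintype.card_fin] at this
    lia
  refine (_root_.star_or_triangle hs hc hx hy hxy).imp_left ?_
  rintro ⟨a, ha⟩
  exact isConjSet_starTranspositions_of_forall_eq_swap hk a ha

theorem IsTotallySymmetric.isConjSet_starTranspositions {Y : Set (Perm (Fin n))}
    (hY : IsTotallySymmetric Y) (hn : 5 ≤ n) (hk : Y.ncard = n - 1) (hs : ∀ y ∈ Y, y.IsSwap) :
    IsConjSet Y (starTranspositions n) := by
  refine (hY.star_or_triangle (by lia) hk hs).resolve_right ?_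
  rintro ⟨a, b, c, -, -, -, rfl⟩
  have h₁ := Set.ncard_insert_le (swap a b) {swap a c, swap b c}
  have h₂ := Set.ncard_insert_le (swap a c) {swap b c}
  rw [Set.ncard_singleton] at h₂
  lia

theorem IsTotallySymmetric.ne_one {G : Type*} [Group G] {Y : Set G} (hY : IsTotallySymmetric Y)
    (hk : 1 < Y.ncard) {y : G} (hy : y ∈ Y) : y ≠ 1 := by
  rintro rfl
  have : Y ⊆ {1} := fun z hz => isConj_one_right.1 ((hY.isConj hy hz))
  have := Set.ncard_le_ncard this
  rw [Set.ncard_singleton] at this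
  lia

end Swaps

/-! ### A non-inner automorphism of `S₆` -/

section OuterAutomorphism

/-- The six synthematic totals of `{0, …, 5}`: the `i`-th one is a set of five triple
transpositions whose transpositions together are the fifteen transpositions of `S₆`. -/
def synthematicTotal (i : Fin 6) : Finset (Perm (Fin 6)) :=
  ({swap 0 1 * swap 2 3 * swap 4 5, swap 0 2 * swap 1 4 * swap 3 5,
    swap 0 3 * swap 1 5 * swap 2 4, swap 0 4 * swap 1 3 * swap 2 5,
    swap 0 5 * swap 1 2 * swap 3 4} : Finset (Perm (Fin 6))).image
    fun x => swap 0 i * x * (swap 0 i)⁻¹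

theorem injective_synthematicTotal : Function.Injective synthematicTotal := by
  have h : ∀ i j : Fin 6, synthematicTotal i = synthematicTotal j → i = j := by decide +kernel
  exact h

theorem image_conj_mul {G : Type*} [Group G] [DecidableEq G] (g h : G) (s : Finset G) :
    s.image (fun x => g * h * x * (g * h)⁻¹) =
      (s.image fun x => h * x * h⁻¹).image fun x => g * x * g⁻¹ := by
  rw [Finset.image_image]
  congr 1
  funext x
  simp [mul_assoc]

theorem exists_image_conj_synthematicTotal (g : Perm (Fin 6)) :
    ∀ i, ∃ j, (synthematicTotal i).image (fun x => g * x * g⁻¹) = synthematicTotal j := by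
  have hstar : ∀ k i : Fin 6, ∃ j, (synthematicTotal i).image
      (fun x => swap 0 k * x * (swap 0 k)⁻¹) = synthematicTotal j := by decide +kernel
  -- By finiteness the star generates `S₆` as a monoid, so the check on `swap 0 k` propagates to all
  -- words.
  have hg : g ∈ Submonoid.closure (starTranspositions 6) := by
    rw [← Subgroup.closure_toSubmonoid_of_finite, closure_starTranspositions]; trivial
  induction hg using Submonoid.closure_induction_left with
  | one => exact fun i => ⟨i, by simp⟩
  | mul_left x hx y _ ih =>
    intro i
    obtain ⟨⟨k, _⟩, rfl⟩ := starTranspositions_eq_range 6 ▸ hx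
    obtain ⟨j, hj⟩ := ih i
    rw [image_conj_mul, hj]
    exact hstar k j

/-- The action of `S₆` on the six synthematic totals. -/
noncomputable def synthematicAction : Perm (Fin 6) →* Function.End (Fin 6) where
  toFun g i := (exists_image_conj_synthematicTotal g i).choose
  map_one' := by
    funext i
    refine injective_synthematicTotal ?_
    rw [← (exists_image_conj_synthematicTotal 1 i).choose_spec]
    simp [Function.End.one_def]
  map_mul' g h := by
    funext i
    refine injective_synthematicTotal ?_
    rw [← (exists_image_conj_synthematicTotal (g * h) i).choose_spec, image_conj_mul,
      (exists_image_conj_synthematicTotal h i).choose_spec,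
      (exists_image_conj_synthematicTotal g _).choose_spec]
    rfl

theorem image_conj_synthematicTotal (g : Perm (Fin 6)) (i : Fin 6) :
    (synthematicTotal i).image (fun x => g * x * g⁻¹) =
      synthematicTotal (synthematicAction.toHomPerm g i) :=
  (exists_image_conj_synthematicTotal g i).choose_spec

/-- The action on the totals is faithful, hence an automorphism. The transposition `(0 1)` fixes no
total, whereas its conjugate by `g` would fix `g 2`. -/
theorem exists_not_isInnerAut :
    ∃ ρ : Perm (Fin 6) ≃* Perm (Fin 6), ¬ IsInnerAut ρ := by
  have hker : ∀ g : Perm (Fin 6), (∀ i, (synthematicTotal i).image (fun x => g * x * g⁻¹) =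
      synthematicTotal i) → g = 1 := by decide +kernel
  have hmove : ∀ i, (synthematicTotal i).image (fun x => swap 0 1 * x * (swap 0 1)⁻¹) ≠
      synthematicTotal i := by decide +kernel
  have hinj : Function.Injective synthematicAction.toHomPerm := by
    refine (injective_iff_map_eq_one _).2 fun g hg => hker g fun i => ?_
    rw [image_conj_synthematicTotal, hg, Perm.one_apply]
  refine ⟨MulEquiv.ofBijective _ (Finite.injective_iff_bijective.1 hinj), ?_⟩
  rintro ⟨g, hg⟩
  refine hmove (g 2) ?_
  rw [image_conj_synthematicTotal]
  have h := congrArg (fun σ : Perm (Fin 6) => σ (g 2)) (hg (swap 0 1))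
  simp only [MulEquiv.ofBijective_apply] at h
  rw [h, ← swap_apply_apply, swap_apply_of_ne_of_ne] <;> simp

end OuterAutomorphism

/-! ### Centralizers in `S₅` -/

section Five

/-- One representative for each of the seven cycle types. -/
theorem exists_conj_mem_representatives_five : ∀ y : Perm (Fin 5), ∃ g : Perm (Fin 5),
    g * y * g⁻¹ ∈ [1, swap 0 1, swap 0 1 * swap 1 2, swap 0 1 * swap 1 2 * swap 3 4,
      swap 0 1 * swap 2 3, swap 0 1 * swap 1 2 * swap 2 3,
      swap 0 1 * swap 1 2 * swap 2 3 * swap 3 4] := by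
  decide +kernel

theorem mul_comm_of_forall_mem_zpowers {G : Type*} [Group G] {y w : G}
    (h : ∀ a, a * y = y * a → a ∈ Subgroup.zpowers w) {a b : G} (ha : a * y = y * a)
    (hb : b * y = y * b) : a * b = b * a := by
  obtain ⟨i, rfl⟩ := h a ha
  obtain ⟨j, rfl⟩ := h b hb
  exact (Commute.refl w).zpow_zpow i j

/-- In `S₅` the centralizer of a permutation that is neither the identity nor a transposition
is cyclic or of exponent dividing `8`. -/
theorem commute_or_pow_eight_eq_one_of_mem_representatives {y : Perm (Fin 5)}
    (hy : y ∈ [swap 0 1 * swap 1 2, swap 0 1 * swap 1 2 * swap 3 4,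
      swap 0 1 * swap 2 3, swap 0 1 * swap 1 2 * swap 2 3,
      swap 0 1 * swap 1 2 * swap 2 3 * swap 3 4]) {a b : Perm (Fin 5)} (ha : a * y = y * a)
    (hb : b * y = y * b) : a * b = b * a ∨ a ^ 8 = 1 := by
  have h₁ : ∀ a : Perm (Fin 5), a * (swap 0 1 * swap 1 2) = swap 0 1 * swap 1 2 * a →
      ∃ k : Fin 6, (swap 0 1 * swap 1 2 * swap 3 4) ^ k.val = a := by decide +kernel
  have h₂ : ∀ a : Perm (Fin 5), a * (swap 0 1 * swap 1 2 * swap 3 4) =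
      swap 0 1 * swap 1 2 * swap 3 4 * a →
      ∃ k : Fin 6, (swap 0 1 * swap 1 2 * swap 3 4) ^ k.val = a := by decide +kernel
  have h₃ : ∀ a : Perm (Fin 5), a * (swap 0 1 * swap 2 3) = swap 0 1 * swap 2 3 * a →
      a ^ 8 = 1 := by decide +kernel
  have h₄ : ∀ a : Perm (Fin 5), a * (swap 0 1 * swap 1 2 * swap 2 3) =
      swap 0 1 * swap 1 2 * swap 2 3 * a → a ^ 8 = 1 := by decide +kernel
  have h₅ : ∀ a : Perm (Fin 5), a * (swap 0 1 * swap 1 2 * swap 2 3 * swap 3 4) =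
      swap 0 1 * swap 1 2 * swap 2 3 * swap 3 4 * a →
      ∃ k : Fin 5, (swap 0 1 * swap 1 2 * swap 2 3 * swap 3 4) ^ k.val = a := by decide +kernel
  simp only [List.mem_cons, List.not_mem_nil, or_false] at hy
  rcases hy with rfl | rfl | rfl | rfl | rfl
  · exact .inl (mul_comm_of_forall_mem_zpowers
      (fun a ha => let ⟨k, hk⟩ := h₁ a ha; ⟨k.val, by simpa using hk⟩) ha hb)
  · exact .inl (mul_comm_of_forall_mem_zpowers
      (fun a ha => let ⟨k, hk⟩ := h₂ a ha; ⟨k.val, by simpa using hk⟩) ha hb)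
  · exact .inr (h₃ a ha)
  · exact .inr (h₄ a ha)
  · exact .inl (mul_comm_of_forall_mem_zpowers
      (fun a ha => let ⟨k, hk⟩ := h₅ a ha; ⟨k.val, by simpa using hk⟩) ha hb)

theorem isSwap_conj_iff {α : Type*} [DecidableEq α] [Fintype α] (g y : Perm α) :
    (g * y * g⁻¹).IsSwap ↔ y.IsSwap := by
  rw [isSwap_iff_cycleType, isSwap_iff_cycleType, cycleType_conj]

/-- The bound `3! ≤ |C(y)|` does not exclude 3-cycles, type `{3, 2}` or double transpositions, whose
centralizers have orders `6`, `6` and `8`; their structure is used instead. -/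
theorem IsTotallySymmetric.isSwap_of_mem_five {Y : Set (Perm (Fin 5))}
    (hY : IsTotallySymmetric Y) (hk : Y.ncard = 4) {y : Perm (Fin 5)} (hy : y ∈ Y) :
    y.IsSwap := by
  have hne := hY.ne_one (by lia) hy
  obtain ⟨g, hg⟩ := exists_conj_mem_representatives_five y
  have hgy : g * y * g⁻¹ ∈ MulAut.conj g '' Y := ⟨y, hy, rfl⟩
  obtain ⟨a, b, ha, hb, hab, ha8⟩ :=
    (hY.image (MulAut.conj g)).exists_not_commute_of_ncard_eq_four
      (by rwa [Set.ncard_image_of_injective _ (MulAut.conj g).injective]) hgy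
  rw [List.mem_cons, List.mem_cons] at hg
  rcases hg with hg | hg | hg
  · exact absurd (conj_eq_one_iff.1 hg) hne
  · exact (isSwap_conj_iff g y).1 (hg ▸ ⟨0, 1, by decide, rfl⟩)
  · exact ((commute_or_pow_eight_eq_one_of_mem_representatives hg ha hb).elim hab ha8).elim

end Five

/-! ### The generic case -/

section Generic

theorem IsTotallySymmetric.isSwap_or_cycleType_of_mem {n : ℕ} {Y : Set (Perm (Fin n))}
    (hY : IsTotallySymmetric Y) (hn : 6 ≤ n) (hk : Y.ncard = n - 1) {y : Perm (Fin n)}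
    (hy : y ∈ Y) : y.IsSwap ∨ n = 6 ∧ y.cycleType = {2, 2, 2} := by
  by_contra! h
  have h₁ := card_centralizer_lt hn (hY.ne_one (by lia) hy) h.1 h.2
  have h₂ := hY.factorial_le_card_centralizer hy
  rw [hk, Nat.sub_sub] at h₂
  lia

theorem isTotallySymmetric_and_ncard_iff_isConjSet_starTranspositions {n : ℕ} (hn : 5 ≤ n)
    (h6 : n ≠ 6) (Y : Set (Perm (Fin n))) :
    (IsTotallySymmetric Y ∧ Y.ncard = n - 1) ↔ IsConjSet Y (starTranspositions n) := by
  have : NeZero n := ⟨by lia⟩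
  refine ⟨fun ⟨hY, hk⟩ => hY.isConjSet_starTranspositions hn hk fun y hy => ?_, fun h =>
    ⟨h.isTotallySymmetric (isTotallySymmetric_starTranspositions n),
      h.ncard_eq.trans (ncard_starTranspositions n)⟩⟩
  obtain rfl | hn := hn.eq_or_lt
  · exact hY.isSwap_of_mem_five hk hy
  · exact (hY.isSwap_or_cycleType_of_mem hn hk hy).resolve_right fun h => h6 h.1

end Generic

/-! ### Classification in `S₆` -/

section Six

theorem IsTotallySymmetric.isConjSet_or_cycleType_six {Y : Set (Perm (Fin 6))}
    (hY : IsTotallySymmetric Y) (hk : Y.ncard = 5) :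
    IsConjSet Y (starTranspositions 6) ∨ ∀ y ∈ Y, y.cycleType = {2, 2, 2} := by
  by_contra! h
  obtain ⟨h₁, y, hy, hy'⟩ := h
  refine h₁ (hY.isConjSet_starTranspositions (by lia) hk fun z hz => ?_)
  have hy₂ := (hY.isSwap_or_cycleType_of_mem le_rfl hk hy).resolve_right fun h => hy' h.2
  rw [isSwap_iff_cycleType] at hy₂ ⊢
  rw [← hy₂]
  exact isConj_iff_cycleType_eq.1 (hY.isConj hz hy)

theorem isTotallySymmetric_and_ncard_iff_six {ρ : Perm (Fin 6) ≃* Perm (Fin 6)}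
    (hρ : ¬ IsInnerAut ρ) (Y : Set (Perm (Fin 6))) :
    (IsTotallySymmetric Y ∧ Y.ncard = 5) ↔
      (IsConjSet Y (starTranspositions 6) ∨ IsConjSet Y (ρ '' starTranspositions 6)) := by
  have hX := isTotallySymmetric_starTranspositions 6
  have hXk := ncard_starTranspositions 6
  have hρk : (ρ '' starTranspositions 6).ncard = 5 :=
    (Set.ncard_image_of_injective _ ρ.injective).trans hXk
  constructor
  · rintro ⟨hY, hk⟩
    refine (hY.isConjSet_or_cycleType_six hk).imp_right fun hY₂ => ?_
    have hρ₂ := ((hX.image ρ).isConjSet_or_cycleType_six hρk).resolve_left fun h =>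
      hρ (isInnerAut_of_isConjSet_image ρ h)
    have h01 : swap 0 1 ∈ starTranspositions 6 := ⟨0, 1, rfl, by decide, rfl⟩
    have hZ := (hY.image ρ.symm).isConjSet_or_cycleType_six
      ((Set.ncard_image_of_injective _ ρ.symm.injective).trans hk)
    have hconj := (hZ.resolve_right fun hZ₂ => ?_).image ρ
    · simpa [Set.image_image] using hconj
    obtain ⟨y, hy⟩ := Set.nonempty_of_ncard_ne_zero (s := Y) (by lia)
    -- Triple transpositions form one class, so `ρ.symm y` is conjugate to `(0 1)` and cannot be a
    -- triple transposition.
    have hc : IsConj (ρ (swap 0 1)) y := by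
      rw [isConj_iff_cycleType_eq, hY₂ y hy, hρ₂ _ ⟨_, h01, rfl⟩]
    have hc' : IsConj (swap 0 1) (ρ.symm y) := by
      simpa using (ρ.symm : Perm (Fin 6) →* Perm (Fin 6)).map_isConj hc
    rw [isConj_iff_cycleType_eq, hZ₂ _ ⟨y, hy, rfl⟩,
      isSwap_iff_cycleType.1 ⟨0, 1, by decide, rfl⟩] at hc'
    exact absurd hc' (by decide)
  · rintro (h | h)
    · exact ⟨h.isTotallySymmetric hX, h.ncard_eq.trans hXk⟩
    · exact ⟨h.isTotallySymmetric (hX.image ρ), h.ncard_eq.trans hρk⟩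

end Six

/-! ### Classification in `S₄` -/

section Four

/-- The three products of two disjoint transpositions in `S₄`. -/
def doubleTranspositions : Fin 3 → Perm (Fin 4) :=
  ![swap 0 1 * swap 2 3, swap 0 2 * swap 1 3, swap 0 3 * swap 1 2]

theorem injective_doubleTranspositions : Function.Injective doubleTranspositions := by
  have h : ∀ i j, doubleTranspositions i = doubleTranspositions j → i = j := by decide +kernel
  exact h

theorem range_fin_three {α : Type*} (a b c : α) : Set.range ![a, b, c] = {a, b, c} := by
  ext x
  simp only [Set.mem_range, Fin.exists_fin_succ, Matrix.cons_val_zero, Matrix.cons_val_succ,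
    Set.mem_insert_iff, Set.mem_singleton_iff, IsEmpty.exists_iff, or_false, eq_comm]

theorem ncard_range_fin_three {α : Type*} {f : Fin 3 → α} (hf : Function.Injective f) :
    (Set.range f).ncard = 3 := by
  rw [← Set.image_univ, Set.ncard_image_of_injective _ hf, Set.ncard_univ, Nat.card_eq_fintype_card,
    Fintype.card_fin]

theorem isTotallySymmetric_range_doubleTranspositions :
    IsTotallySymmetric (Set.range doubleTranspositions) := by
  rw [isTotallySymmetric_range_iff injective_doubleTranspositions]
  decide +kernel

/-- The three transpositions of the letters `0`, `1`, `2`. -/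
def triangle (n : ℕ) [NeZero n] : Fin 3 → Perm (Fin n) := ![swap 0 1, swap 0 2, swap 1 2]

theorem injective_triangle_four : Function.Injective (triangle 4) := by
  have h : ∀ i j, triangle 4 i = triangle 4 j → i = j := by decide +kernel
  exact h

theorem isTotallySymmetric_range_triangle_four : IsTotallySymmetric (Set.range (triangle 4)) := by
  rw [isTotallySymmetric_range_iff injective_triangle_four]
  decide +kernel

/-- Here `h` cycles a triple starting at `a`, and `g` fixes `a` while exchanging the other two. For
instance, a 3-cycle is excluded because its centralizer has odd order. The disjunctions are ordered
so that the search over `g` comes last. -/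
theorem involution_of_conj_triple_four : ∀ a h : Perm (Fin 4), a ≠ h * a * h⁻¹ → a * a = 1 ∨
    h * (h * (h * a * h⁻¹) * h⁻¹) * h⁻¹ ≠ a ∨ ∀ g : Perm (Fin 4), g * a * g⁻¹ = a →
      g * (h * a * h⁻¹) * g⁻¹ ≠ h * (h * a * h⁻¹) * h⁻¹ ∨
        g * (h * (h * a * h⁻¹) * h⁻¹) * g⁻¹ ≠ h * a * h⁻¹ := by
  decide +kernel

theorem involution_cases_four : ∀ a : Perm (Fin 4), a * a = 1 →
    a = 1 ∨ (∃ i j, i ≠ j ∧ a = swap i j) ∨ ∃ i, doubleTranspositions i = a := by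
  decide +kernel

theorem conj_doubleTranspositions_mem (g : Perm (Fin 4)) (i : Fin 3) :
    ∃ j, doubleTranspositions j = g * doubleTranspositions i * g⁻¹ := by
  revert g i
  decide +kernel

theorem IsTotallySymmetric.mul_self_eq_one_four {Y : Set (Perm (Fin 4))}
    (hY : IsTotallySymmetric Y) (hk : Y.ncard = 3) {y : Perm (Fin 4)} (hy : y ∈ Y) :
    y * y = 1 := by
  obtain ⟨f, hf, rfl, rfl⟩ := exists_injective_range_eq_of_mem hk hy
  rw [isTotallySymmetric_range_iff hf] at hY
  obtain ⟨h, hh⟩ := hY (swap 0 1 * swap 1 2)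
  obtain ⟨g, hg⟩ := hY (swap 1 2)
  have h0 : h * f 0 * h⁻¹ = f 1 := (hh 0).trans (congrArg f (by decide))
  have h1 : h * f 1 * h⁻¹ = f 2 := (hh 1).trans (congrArg f (by decide))
  have h2 : h * f 2 * h⁻¹ = f 0 := (hh 2).trans (congrArg f (by decide))
  have key := involution_of_conj_triple_four (f 0) h
    (by rw [h0]; exact fun h => absurd (hf h) (by decide))
  rw [h0, h1, h2] at key
  refine key.resolve_right ?_
  rintro (hne | hne)
  · exact hne rfl
  · exact (hne g (hg 0)).elim (· (hg 1)) (· (hg 2))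

theorem isConjSet_triangle_four {a b c : Fin 4} (hab : a ≠ b) (hac : a ≠ c) (hbc : b ≠ c) :
    IsConjSet {swap a b, swap a c, swap b c}
      ({swap 0 1, swap 0 2, swap 1 2} : Set (Perm (Fin 4))) := by
  have : ∀ a b c : Fin 4, a ≠ b → a ≠ c → b ≠ c →
      ∃ g : Perm (Fin 4), g 0 = a ∧ g 1 = b ∧ g 2 = c := by
    decide +kernel
  obtain ⟨g, rfl, rfl, rfl⟩ := this a b c hab hac hbc
  exact ⟨g, by simp [Set.image_insert_eq, swap_apply_apply]⟩

theorem isTotallySymmetric_and_ncard_iff_four (Y : Set (Perm (Fin 4))) :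
    (IsTotallySymmetric Y ∧ Y.ncard = 3) ↔
      (IsConjSet Y (starTranspositions 4) ∨
        IsConjSet Y {swap 0 1, swap 0 2, swap 1 2} ∨
        Y = {swap 0 1 * swap 2 3, swap 0 2 * swap 1 3, swap 0 3 * swap 1 2}) := by
  have htri : ({swap 0 1, swap 0 2, swap 1 2} : Set (Perm (Fin 4))) = Set.range (triangle 4) :=
    (range_fin_three _ _ _).symm
  have hdbl : ({swap 0 1 * swap 2 3, swap 0 2 * swap 1 3, swap 0 3 * swap 1 2} :
      Set (Perm (Fin 4))) = Set.range doubleTranspositions := (range_fin_three _ _ _).symm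
  constructor
  · rintro ⟨hY, hk⟩
    by_cases hs : ∀ y ∈ Y, y.IsSwap
    · refine (hY.star_or_triangle le_rfl hk hs).imp_right ?_
      rintro ⟨a, b, c, hab, hac, hbc, rfl⟩
      exact .inl (isConjSet_triangle_four hab hac hbc)
    · push Not at hs
      obtain ⟨y, hy, hys⟩ := hs
      obtain ⟨i, rfl⟩ := ((involution_cases_four y (hY.mul_self_eq_one_four hk hy)).resolve_left
        (hY.ne_one (by lia) hy)).resolve_left hys
      refine .inr (.inr ?_)
      rw [hdbl]
      -- The double transpositions form a class of exactly three elements, so `Y` fills it.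
      refine Set.eq_of_subset_of_ncard_le (fun z hz => ?_)
        (by rw [ncard_range_fin_three injective_doubleTranspositions, hk]) (Set.toFinite _)
      obtain ⟨g, rfl⟩ := isConj_iff.1 (hY.isConj hy hz)
      exact conj_doubleTranspositions_mem g i
  · rw [htri, hdbl]
    rintro (h | h | rfl)
    · exact ⟨h.isTotallySymmetric (isTotallySymmetric_starTranspositions 4),
        h.ncard_eq.trans (ncard_starTranspositions 4)⟩
    · exact ⟨h.isTotallySymmetric isTotallySymmetric_range_triangle_four,
        h.ncard_eq.trans (ncard_range_fin_three injective_triangle_four)⟩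
    · exact ⟨isTotallySymmetric_range_doubleTranspositions,
        ncard_range_fin_three injective_doubleTranspositions⟩

end Four

/-! ### Classification in `S₃` -/

section Three

theorem injective_triangle_three : Function.Injective (triangle 3) := by
  have h : ∀ i j, triangle 3 i = triangle 3 j → i = j := by decide +kernel
  exact h

theorem isTotallySymmetric_range_triangle_three : IsTotallySymmetric (Set.range (triangle 3)) := by
  rw [isTotallySymmetric_range_iff injective_triangle_three]
  decide +kernel

/-- The two three-cycles of `S₃`. -/
def threeCycles : Fin 2 → Perm (Fin 3) := ![swap 0 1 * swap 1 2, swap 1 2 * swap 0 1]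

theorem isTotallySymmetric_range_threeCycles : IsTotallySymmetric (Set.range threeCycles) := by
  have h : ∀ i j, threeCycles i = threeCycles j → i = j := by decide +kernel
  rw [isTotallySymmetric_range_iff h]
  decide +kernel

/-- Every conjugacy class of `S₃` consists of the identity, the transpositions or the
three-cycles. -/
theorem conjugatesOf_subset_three (a : Perm (Fin 3)) :
    conjugatesOf a ⊆ {1} ∨ conjugatesOf a ⊆ Set.range (triangle 3) ∨
      conjugatesOf a ⊆ Set.range threeCycles := by
  have h : ∀ a : Perm (Fin 3), (∀ g : Perm (Fin 3), g * a * g⁻¹ = 1) ∨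
      (∀ g : Perm (Fin 3), ∃ i, triangle 3 i = g * a * g⁻¹) ∨
      ∀ g : Perm (Fin 3), ∃ i, threeCycles i = g * a * g⁻¹ := by decide +kernel
  refine (h a).imp ?_ (Or.imp ?_ ?_) <;>
  · intro h b hb
    obtain ⟨g, rfl⟩ := isConj_iff.1 hb
    exact h g

theorem isTotallySymmetric_iff_three (Y : Set (Perm (Fin 3))) :
    IsTotallySymmetric Y ↔ ∃ a : Perm (Fin 3), Y ⊆ conjugatesOf a := by
  constructor
  · intro hY
    obtain rfl | ⟨a, ha⟩ := Y.eq_empty_or_nonempty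
    · exact ⟨1, Set.empty_subset _⟩
    · exact ⟨a, fun b hb => hY.isConj ha hb⟩
  -- Each full class is totally symmetric, and subsets inherit this.
  · rintro ⟨a, ha⟩
    obtain h | h | h := conjugatesOf_subset_three a
    · have h₁ : IsTotallySymmetric ({1} : Set (Perm (Fin 3))) := fun σ =>
        ⟨1, fun y => by rw [Subsingleton.elim (σ y) y]; simp⟩
      exact h₁.mono (ha.trans h)
    · exact isTotallySymmetric_range_triangle_three.mono (ha.trans h)
    · exact isTotallySymmetric_range_threeCycles.mono (ha.trans h)

theorem IsTotallySymmetric.ncard_le_three {Y : Set (Perm (Fin 3))} (hY : IsTotallySymmetric Y) :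
    Y.ncard ≤ 3 := by
  have hrange : ∀ {k : ℕ} (f : Fin k → Perm (Fin 3)), (Set.range f).ncard ≤ k := fun {k} f => by
    rw [← Set.image_univ]
    exact (Set.ncard_image_le).trans (by simp [Set.ncard_univ])
  obtain ⟨a, ha⟩ := (isTotallySymmetric_iff_three Y).1 hY
  obtain h | h | h := conjugatesOf_subset_three a
  · exact (Set.ncard_le_ncard (ha.trans h)).trans (by simp)
  · exact (Set.ncard_le_ncard (ha.trans h)).trans (hrange _)
  · exact (Set.ncard_le_ncard (ha.trans h)).trans ((hrange _).trans (by lia))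

end Three

theorem theorem1p2 :
    -- generic `n`
    (∀ n : ℕ, 1 ≤ n → n ≠ 2 → n ≠ 3 → n ≠ 4 → n ≠ 6 →
      ∀ Y : Set (Equiv.Perm (Fin n)),
        (IsTotallySymmetric Y ∧ Y.ncard = n - 1) ↔ IsConjSet Y (starTranspositions n)) ∧
    -- `n = 6`
    ((∃ ρ : Equiv.Perm (Fin 6) ≃* Equiv.Perm (Fin 6), ¬ IsInnerAut ρ) ∧
      ∀ ρ : Equiv.Perm (Fin 6) ≃* Equiv.Perm (Fin 6), ¬ IsInnerAut ρ →
        ∀ Y : Set (Equiv.Perm (Fin 6)),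
          (IsTotallySymmetric Y ∧ Y.ncard = 5) ↔
            (IsConjSet Y (starTranspositions 6) ∨
              IsConjSet Y (ρ '' starTranspositions 6))) ∧
    -- `n = 4`
    (∀ Y : Set (Equiv.Perm (Fin 4)),
      (IsTotallySymmetric Y ∧ Y.ncard = 3) ↔
        (IsConjSet Y (starTranspositions 4) ∨
          IsConjSet Y {Equiv.swap 0 1, Equiv.swap 0 2, Equiv.swap 1 2} ∨
          Y = {Equiv.swap 0 1 * Equiv.swap 2 3, Equiv.swap 0 2 * Equiv.swap 1 3,
            Equiv.swap 0 3 * Equiv.swap 1 2})) ∧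
    -- `n = 3`
    ((∀ Y : Set (Equiv.Perm (Fin 3)),
        IsTotallySymmetric Y ↔ ∃ a : Equiv.Perm (Fin 3), Y ⊆ conjugatesOf a) ∧
      (∀ Y : Set (Equiv.Perm (Fin 3)), IsTotallySymmetric Y → Y.ncard ≤ 3) ∧
      IsTotallySymmetric
        ({Equiv.swap 0 1, Equiv.swap 0 2, Equiv.swap 1 2} : Set (Equiv.Perm (Fin 3))) ∧
      ({Equiv.swap 0 1, Equiv.swap 0 2, Equiv.swap 1 2} :
        Set (Equiv.Perm (Fin 3))).ncard = 3) := by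
  have htri : ({swap 0 1, swap 0 2, swap 1 2} : Set (Perm (Fin 3))) = Set.range (triangle 3) :=
    (range_fin_three _ _ _).symm
  refine ⟨fun n h1 h2 h3 h4 h6 Y => ?_,
    ⟨exists_not_isInnerAut, fun ρ hρ Y => isTotallySymmetric_and_ncard_iff_six hρ Y⟩,
    isTotallySymmetric_and_ncard_iff_four, isTotallySymmetric_iff_three,
    fun Y hY => hY.ncard_le_three, ?_, ?_⟩
  -- For `n = 1` the star is empty, and both sides say that `Y` is empty.
  · obtain rfl | h1 := h1.eq_or_lt
    · have hX : starTranspositions 1 = ∅ :=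
        Set.eq_empty_of_forall_notMem fun τ ⟨a, i, _, hi, _⟩ => hi (Subsingleton.elim _ _)
      rw [Set.ncard_eq_zero, isConjSet_iff]
      simp only [hX, Set.image_empty, exists_const, and_iff_right_iff_imp]
      rintro rfl
      exact fun σ => ⟨1, fun y => y.2.elim⟩
    · exact isTotallySymmetric_and_ncard_iff_isConjSet_starTranspositions (by lia) h6 Y
  · rw [htri]
    exact isTotallySymmetric_range_triangle_three
  · rw [htri]
    exact ncard_range_fin_three injective_triangle_three
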